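/- There are universal constants $\ell_l,\ell_u>0$ such that the following holds for every $n$ and all privacy levels $\varepsilon_1,\dots,\varepsilon_n\in[0,1]$. Let $\mathcal X=[-\tfrac12,\tfrac12]$ and let $\mathcal P^*$ be the set of probability distributions $P$ on $\mathbb R$ such that $|X|\le\frac12$ almost surely for $X\sim P$; write $\theta(P)=\mathbb E_{X\sim P}[X]$. A randomized channel $\mathcal C$ on $\mathcal X$ (a Markov kernel) with values in a measurable space $\hat{\mathcal X}$ is called $\varepsilon$-locally differentially private if $\mathbb P(\mathcal C(x)\in W)\le e^{\varepsilon}\,\mathbb P(\mathcal C(x')\in W)$ for all $x,x'\in\mathcal X$ and all measurable $W\subseteq\hat{\mathcal X}$. Let $\mathcal Q_l(\boldsymbol\varepsilon)$ be the class of mechanisms $\mathcal M(x_1,\dots,x_n)=(\mathcal C_i(x_i))_{i=1}^n$, where $\mathcal C_i$ is an $\varepsilon_i$-locally differentially private channel with values in $\hat{\mathcal X}$ and the channels use independent randomness. (i) For every measurable space $\hat{\mathcal X}$, with the convention $1/0=\infty$, $$\inf_{\hat\theta,\ \mathcal M\in\mathcal Q_l(\boldsymbol\varepsilon)}\ \sup_{P\in\mathcal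 P^*}\ \mathbb E\left[\left|\hat\theta(\mathcal M(X_1,\dots,X_n))-\theta(P)\right|^2\right]\ \ge\ \ell_l\,\min\left\{\frac{1}{\sum_{i=1}^n\varepsilon_i^2},\,1\right\},$$ where $\hat\theta$ ranges over all (possibly randomized) measurable real-valued estimators on $\hat{\mathcal X}^n$, and the expectation is over $X_1,\dots,X_n$ i.i.d. with law $P$, the mechanism, and the estimator. (ii) Suppose that at least one $\varepsilon_i$ is positive. Let user $i$ release $\hat x_i=x_i+Z_i$, where the $Z_i$ are independent of each other and of the data and $Z_i\sim\mathrm{Laplace}(1/\varepsilon_i)$, i.e. $Z_i$ has density $z\mapsto\frac{\varepsilon_i}{2}e^{-\varepsilon_i|z|}$ (a user with $\varepsilon_i=0$ releases the constant $\hat x_i=0$). Then $(x_1,\dots,x_n)\mapsto(\hat x_1,\dots,\hat x_n)$ belongs to $\mathcal Q_l(\boldsymbol\varepsilon)$ with $\hat{\mathcal X}=\mathbb R$, the weights $w_i=\varepsilon_i^2/\sum_{j=1}^n\varepsilon_j^2$ sum to $1$, and the linear estimator $\hat\theta=\sum_{i=1}^n w_i\hat x_i$ satisfies $$\mathbb E\left[|\hat\theta-\theta(P)|^2\right]\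 \le\ \frac{\ell_u}{\sum_{i=1}^n\varepsilon_i^2}\qquad\text{for all }P\in\mathcal P^*.$$ -/

import Mathlib

open MeasureTheory ProbabilityTheory
open scoped ENNReal

noncomputable section

namespace LocalDP

/-- A randomized channel `κ` (a kernel) from a data space `S ⊆ ℝ` to a measurable space `Y` is
`ε`-locally differentially private if `ℙ(κ(x) ∈ W) ≤ exp(ε) * ℙ(κ(x') ∈ W)` for all data points
`x, x' ∈ S` and all measurable `W`. Only the values of `κ` on `S` matter. -/
def IsLocallyDP {Y : Type*} [MeasurableSpace Y] (S : Set ℝ) (ε : ℝ) (κ : Kernel ℝ Y) : Prop :=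
  ∀ x ∈ S, ∀ x' ∈ S, ∀ W : Set Y, MeasurableSet W →
    κ x W ≤ ENNReal.ofReal (Real.exp ε) * κ x' W

/-- The mechanism `x ↦ (C₁(x₁), …, Cₙ(xₙ))` in which each user applies her own channel to her own
data point, with independent randomness across users. -/
def productMechanism {n : ℕ} {Y : Type*} [MeasurableSpace Y]
    (C : Fin n → Kernel ℝ Y) [∀ i, IsMarkovKernel (C i)] :
    Kernel (Fin n → ℝ) (Fin n → Y) where
  toFun x := Measure.pi fun i => C i (x i)
  measurable' := by
    refine Measurable.measure_of_isPiSystem_of_isProbabilityMeasure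
      (S := Set.pi Set.univ '' Set.pi Set.univ fun _ : Fin n => {s : Set Y | MeasurableSet s})
      generateFrom_pi.symm isPiSystem_pi ?_
    rintro _ ⟨s, hs, rfl⟩
    simp only [Measure.pi_pi]
    refine Finset.measurable_prod _ fun i _ => ?_
    exact (Kernel.measurable_coe (C i) (hs i (Set.mem_univ i))).comp (measurable_pi_apply i)

/-- The class of mechanisms `(x₁, …, xₙ) ↦ (C₁(x₁), …, Cₙ(xₙ))` with outputs in `Yⁿ`, where `Cᵢ` is
an `εᵢ`-locally differentially private channel on the data space `S`. -/
def locallyDPMechanisms {n : ℕ} (S : Set ℝ) (ε : Fin n → ℝ) (Y : Type*) [MeasurableSpace Y] :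
    Set (Kernel (Fin n → ℝ) (Fin n → Y)) :=
  {M | ∃ (C : Fin n → Kernel ℝ Y) (_ : ∀ i, IsMarkovKernel (C i)),
    (∀ i, IsLocallyDP S (ε i) (C i)) ∧ M = productMechanism C}

/-- The mean `θ(P)` of a distribution on the real line. -/
def mean (P : ProbabilityMeasure ℝ) : ℝ := ∫ x, x ∂(P : Measure ℝ)

/-- The expected squared error `𝔼 |θ̂(M(X₁, …, Xₙ)) - θ(P)|²` for `X₁, …, Xₙ` i.i.d. with law `P`, a
mechanism `M` and a possibly randomized estimator `T` (a kernel). The expectation is over the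
samples, the mechanism and the estimator, and takes values in `[0, ∞]`. -/
def sqRisk {n : ℕ} {Y : Type*} [MeasurableSpace Y] (M : Kernel (Fin n → ℝ) (Fin n → Y))
    (T : Kernel (Fin n → Y) ℝ) (P : ProbabilityMeasure ℝ) : ℝ≥0∞ :=
  ∫⁻ x, ∫⁻ y, ∫⁻ t, ENNReal.ofReal ((t - mean P) ^ 2) ∂(T y) ∂(M x)
    ∂(Measure.pi fun _ : Fin n => (P : Measure ℝ))

/-- The minimax squared error under local differential privacy with privacy levels `ε`, over
the family `F` of distributions: the infimum over all locally private mechanisms with outputs in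
`Yⁿ` and all (possibly randomized) estimators on `Yⁿ` of the worst-case error over `F`. -/
def localMinimax {n : ℕ} (S : Set ℝ) (F : Set (ProbabilityMeasure ℝ)) (ε : Fin n → ℝ)
    (Y : Type*) [MeasurableSpace Y] : ℝ≥0∞ :=
  ⨅ (M : Kernel (Fin n → ℝ) (Fin n → Y)) (_ : M ∈ locallyDPMechanisms S ε Y)
    (T : Kernel (Fin n → Y) ℝ) (_ : IsMarkovKernel T),
    ⨆ P ∈ F, sqRisk M T P

/-- The data space `[-1/2, 1/2]`. -/
def dataSpace : Set ℝ := Set.Icc (-(1 / 2)) (1 / 2)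

/-- The family of distributions `P` with `|X| ≤ 1/2` almost surely for `X ∼ P`. -/
def boundedFamily : Set (ProbabilityMeasure ℝ) :=
  {P | ∀ᵐ x ∂(P : Measure ℝ), |x| ≤ 1 / 2}

/-- The Laplace distribution with parameter `b > 0`, with density `z ↦ exp(-|z| / b) / (2 b)`. -/
def laplaceMeasure (b : ℝ) : Measure ℝ :=
  volume.withDensity fun z => ENNReal.ofReal (1 / (2 * b) * Real.exp (-|z| / b))

lemma isProbabilityMeasure_laplaceMeasure {b : ℝ} (hb : 0 < b) :
    IsProbabilityMeasure (laplaceMeasure b) := by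
  have hint : ∫ z : ℝ, 1 / (2 * b) * Real.exp (-|z| / b) = 1 := by
    have h := integral_comp_abs (f := fun z : ℝ => 1 / (2 * b) * Real.exp (-(1 / b) * z))
    have h2 : ∫ z in Set.Ioi (0 : ℝ), Real.exp (-(1 / b) * z) = b := by
      rw [integral_exp_mul_Ioi (by simpa using hb)]
      simp
    simp only [integral_const_mul, h2] at h
    have hfun : (fun z : ℝ => 1 / (2 * b) * Real.exp (-|z| / b)) =
        fun z : ℝ => 1 / (2 * b) * Real.exp (-(1 / b) * |z|) := by
      funext z
      congr 2
      ring
    simp only [hfun, integral_const_mul, h]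
    field_simp
  have hi : Integrable fun z : ℝ => 1 / (2 * b) * Real.exp (-|z| / b) := by
    by_contra hcon
    rw [integral_undef hcon] at hint
    exact zero_ne_one hint
  constructor
  rw [laplaceMeasure, withDensity_apply _ MeasurableSet.univ, Measure.restrict_univ,
    ← ofReal_integral_eq_lintegral_ofReal hi (Filter.Eventually.of_forall fun z => by positivity),
    hint, ENNReal.ofReal_one]

/-- The Laplace channel at privacy level `ε > 0`: it maps `x` to `x + Z` with `Z ∼ Laplace(1/ε)`.
At the degenerate level `ε = 0`, where no information may be released, it reports `0`. -/
def laplaceChannel (ε : ℝ) : Kernel ℝ ℝ :=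
  if 0 < ε then
    (Kernel.id ×ₖ Kernel.const ℝ (laplaceMeasure (1 / ε))).map fun p : ℝ × ℝ => p.1 + p.2
  else Kernel.const ℝ (Measure.dirac 0)

instance (ε : ℝ) : IsMarkovKernel (laplaceChannel ε) := by
  unfold laplaceChannel
  split_ifs with h
  · have := isProbabilityMeasure_laplaceMeasure (one_div_pos.mpr h)
    exact Kernel.IsMarkovKernel.map _ (by fun_prop)
  · infer_instance

/-- User `i` independently releases `x̂ᵢ = xᵢ + Laplace(1/εᵢ)`. -/
def laplaceMechanism {n : ℕ} (ε : Fin n → ℝ) : Kernel (Fin n → ℝ) (Fin n → ℝ) :=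
  productMechanism fun i => laplaceChannel (ε i)

/-- The linear estimator `y ↦ ∑ i, wᵢ yᵢ`, as a deterministic kernel. -/
def linearEstimator {n : ℕ} (w : Fin n → ℝ) : Kernel (Fin n → ℝ) ℝ :=
  Kernel.deterministic (fun y => ∑ i, w i * y i) (by fun_prop)

/-- The weights `wᵢ = εᵢ² / ∑ⱼ εⱼ²`. -/
def quadraticWeights {n : ℕ} (ε : Fin n → ℝ) (i : Fin n) : ℝ :=
  ε i ^ 2 / ∑ j, ε j ^ 2

end LocalDP

end

/-! Lower bound: Le Cam's two-point method. Compare the point mass at `-1/2` with the law that moves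
mass `δ` to `1/2`; the means differ by `δ`. Privacy says that the laws of a channel at these two
inputs agree up to a factor `exp ε`, so their relative density is `1 + g` with `|g| ≤ exp ε - 1 ≤ 2
ε` (`exists_density_of_le`). Mixing shrinks this to `1 + δ g` (`twoPoint_bind`), and the chi-square
divergence of the full outputs is at most `exp (4 δ² ∑ ε²) - 1` (`integral_sq_prod_sub_one_le`). For
`δ²` of order `min (1 / ∑ ε²) 1` this stays below `1/3`, so no estimator separates the hypotheses
and the error is at least of order `δ²` (`two_point_lower_bound`).

Upper bound: the weighted sum is unbiased with independent summands, so its risk is `∑ wᵢ²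
Var(x̂ᵢ)`. As `Var(x̂ᵢ) ≤ 1/4 + 2/εᵢ² ≤ (9/4)/εᵢ²`, the weights `εᵢ² / ∑ ε²` give `(9/4) / ∑ ε²`. -/

namespace LocalDP

/-! ### Product measures and product mechanisms -/

section Product

variable {ι : Type*} [Fintype ι] {X : ι → Type*} [∀ i, MeasurableSpace (X i)]

lemma lintegral_pi_prod (μ : ∀ i, Measure (X i)) [∀ i, IsProbabilityMeasure (μ i)]
    {f : ∀ i, X i → ℝ≥0∞} (hf : ∀ i, Measurable (f i)) :
    ∫⁻ x, ∏ i, f i (x i) ∂(Measure.pi μ) = ∏ i, ∫⁻ x, f i x ∂(μ i) := by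
  refine (lintegral_prod_eq_prod_lintegral_of_indepFun Finset.univ
    (fun i (x : ∀ i, X i) => f i (x i)) (iIndepFun_pi fun i => (hf i).aemeasurable)
    fun i => (hf i).comp (measurable_pi_apply i)).trans ?_
  refine Finset.prod_congr rfl fun i _ => ?_
  exact (measurePreserving_eval μ i).lintegral_comp (hf i)

/-- The indicator of a box is a product of indicators, so both measures factor in the same way on
boxes. -/
lemma pi_withDensity (μ : ∀ i, Measure (X i)) [∀ i, IsProbabilityMeasure (μ i)]
    {f : ∀ i, X i → ℝ≥0∞} (hf : ∀ i, Measurable (f i))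
    [∀ i, SigmaFinite ((μ i).withDensity (f i))] :
    Measure.pi (fun i => (μ i).withDensity (f i)) =
      (Measure.pi μ).withDensity fun x => ∏ i, f i (x i) := by
  refine Measure.pi_eq fun s hs => ?_
  rw [withDensity_apply _ (MeasurableSet.univ_pi hs),
    ← lintegral_indicator (MeasurableSet.univ_pi hs)]
  have : ((Set.univ.pi s).indicator fun x : ∀ i, X i => ∏ i, f i (x i)) =
      fun x => ∏ i, (s i).indicator (f i) (x i) := by
    classical
    funext x
    by_cases hx : x ∈ Set.univ.pi s
    · rw [Set.indicator_of_mem hx]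
      exact Finset.prod_congr rfl fun i _ => (Set.indicator_of_mem (hx i (Set.mem_univ i)) _).symm
    · rw [Set.indicator_of_notMem hx]
      simp only [Set.mem_univ_pi, not_forall] at hx
      obtain ⟨i, hi⟩ := hx
      exact (Finset.prod_eq_zero (Finset.mem_univ i) (Set.indicator_of_notMem hi _)).symm
  rw [this, lintegral_pi_prod μ fun i => (hf i).indicator (hs i)]
  refine Finset.prod_congr rfl fun i _ => ?_
  rw [lintegral_indicator (hs i), withDensity_apply _ (hs i)]

end Product

/-- Independent inputs and independent channel randomness give independent outputs; this lets the
risk be computed under a product law. -/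
lemma pi_bind_productMechanism {n : ℕ} {Y : Type*} [MeasurableSpace Y]
    (C : Fin n → Kernel ℝ Y) [∀ i, IsMarkovKernel (C i)] (P : Measure ℝ)
    [IsProbabilityMeasure P] :
    (Measure.pi fun _ : Fin n => P).bind (productMechanism C) =
      Measure.pi fun i => P.bind (C i) := by
  refine (Measure.pi_eq fun s hs => ?_).symm
  rw [Measure.bind_apply (MeasurableSet.univ_pi hs) (productMechanism C).measurable.aemeasurable]
  have : ∀ x : Fin n → ℝ, productMechanism C x (Set.univ.pi s) = ∏ i, C i (x i) (s i) :=
    fun x => Measure.pi_pi _ _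
  simp only [this]
  rw [lintegral_pi_prod (fun _ => P) fun i => (C i).measurable_coe (hs i)]
  exact Finset.prod_congr rfl fun i _ =>
    (Measure.bind_apply (hs i) (C i).measurable.aemeasurable).symm

lemma sqRisk_productMechanism {n : ℕ} {Y : Type*} [MeasurableSpace Y]
    (C : Fin n → Kernel ℝ Y) [∀ i, IsMarkovKernel (C i)]
    (T : Kernel (Fin n → Y) ℝ) (P : ProbabilityMeasure ℝ) :
    sqRisk (productMechanism C) T P =
      ∫⁻ y, ∫⁻ t, ENNReal.ofReal ((t - mean P) ^ 2) ∂(T y)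
        ∂(Measure.pi fun i => (P : Measure ℝ).bind (C i)) := by
  have hm : Measurable fun y => ∫⁻ t, ENNReal.ofReal ((t - mean P) ^ 2) ∂(T y) :=
    Measurable.lintegral_kernel (by fun_prop)
  rw [← pi_bind_productMechanism,
    Measure.lintegral_bind (productMechanism C).measurable.aemeasurable hm.aemeasurable, sqRisk]

/-! ### Likelihood ratios, chi-square divergence and Le Cam's inequality -/

section Density

variable {Y : Type*} [MeasurableSpace Y]

/-- Two probability measures within a factor `c` of each other have a relative density within
`c - 1` of one. -/
lemma exists_density_of_le {a b : Measure Y} [IsProbabilityMeasure a] [IsProbabilityMeasure b]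
    {c : ℝ} (hc : 1 ≤ c) (hab : ∀ W, MeasurableSet W → a W ≤ ENNReal.ofReal c * b W)
    (hba : ∀ W, MeasurableSet W → b W ≤ ENNReal.ofReal c * a W) :
    ∃ g : Y → ℝ, Measurable g ∧ (∀ y, |g y| ≤ c - 1) ∧ (∀ y, 0 ≤ 1 + g y) ∧
      a = b.withDensity (fun y => ENNReal.ofReal (1 + g y)) := by
  have hc0 : 0 < c := by linarith
  have hac : a ≪ b := by
    refine Measure.AbsolutelyContinuous.mk fun W hW h => ?_
    simpa [h] using hab W hW
  have hd : b.withDensity (a.rnDeriv b) = a := Measure.withDensity_rnDeriv_eq a b hac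
  have hset : ∀ s, MeasurableSet s → ∫⁻ x in s, a.rnDeriv b x ∂b = a s := fun s hs => by
    rw [← withDensity_apply _ hs, hd]
  have hup : a.rnDeriv b ≤ᵐ[b] fun _ => ENNReal.ofReal c := by
    refine ae_le_of_forall_setLIntegral_le_of_sigmaFinite (Measure.measurable_rnDeriv a b)
      fun s hs _ => ?_
    rw [hset s hs, setLIntegral_const]
    exact hab s hs
  have hlow : (fun _ => 1) ≤ᵐ[b] fun y => ENNReal.ofReal c * a.rnDeriv b y := by
    refine ae_le_of_forall_setLIntegral_le_of_sigmaFinite measurable_const fun s hs _ => ?_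
    rw [lintegral_const_mul _ (Measure.measurable_rnDeriv a b), hset s hs, setLIntegral_const,
      one_mul]
    exact hba s hs
  -- The density lies in `[c⁻¹, c]` only almost everywhere; clamping makes the bounds on `g` hold at
  -- every point.
  refine ⟨fun y => max (c⁻¹ - 1) (min (c - 1) ((a.rnDeriv b y).toReal - 1)), ?_, ?_, ?_, ?_⟩
  · have := (Measure.measurable_rnDeriv a b).ennreal_toReal
    fun_prop
  · intro y
    have h1 : -(c - 1) ≤ c⁻¹ - 1 := by
      have : c * c⁻¹ = 1 := mul_inv_cancel₀ hc0.ne'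
      nlinarith [sq_nonneg (c - 1), inv_pos.mpr hc0]
    have h2 : c⁻¹ ≤ 1 := inv_le_one_of_one_le₀ hc
    rw [abs_le]
    exact ⟨h1.trans (le_max_left _ _), max_le (by linarith) (min_le_left _ _)⟩
  · intro y
    linarith [le_max_left (c⁻¹ - 1) (min (c - 1) ((a.rnDeriv b y).toReal - 1)), inv_pos.mpr hc0]
  · nth_rewrite 1 [← hd]
    refine withDensity_congr_ae ?_
    filter_upwards [hup, hlow] with y h1 h2
    have hfin : a.rnDeriv b y ≠ ∞ := ne_top_of_le_ne_top ENNReal.ofReal_ne_top h1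
    have h3 : (a.rnDeriv b y).toReal ≤ c := ENNReal.toReal_le_of_le_ofReal hc0.le h1
    have h4 : 1 ≤ c * (a.rnDeriv b y).toReal := by
      have := ENNReal.toReal_mono (ENNReal.mul_ne_top ENNReal.ofReal_ne_top hfin) h2
      rwa [ENNReal.toReal_one, ENNReal.toReal_mul, ENNReal.toReal_ofReal hc0.le] at this
    have h5 : c⁻¹ ≤ (a.rnDeriv b y).toReal := by
      rw [inv_le_iff_one_le_mul₀ hc0, mul_comm]
      exact h4
    rw [min_eq_right (by linarith), max_eq_right (by linarith), add_sub_cancel,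
      ENNReal.ofReal_toReal hfin]

lemma integrable_of_abs_le {b : Measure Y} [IsFiniteMeasure b] {g : Y → ℝ} {K : ℝ}
    (hg : Measurable g) (hK : ∀ y, |g y| ≤ K) : Integrable g b :=
  Integrable.of_bound hg.aestronglyMeasurable K (Filter.Eventually.of_forall hK)

lemma integral_eq_zero_of_density {b : Measure Y} [IsProbabilityMeasure b] {g : Y → ℝ}
    (hg : Integrable g b) (h1 : ∀ y, 0 ≤ 1 + g y)
    [hp : IsProbabilityMeasure (b.withDensity fun y => ENNReal.ofReal (1 + g y))] :
    ∫ y, g y ∂b = 0 := by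
  have h := hp.measure_univ
  have hi : Integrable (fun y => 1 + g y) b := (integrable_const 1).add hg
  rw [withDensity_apply _ MeasurableSet.univ, Measure.restrict_univ,
    ← ofReal_integral_eq_lintegral_ofReal hi (Filter.Eventually.of_forall h1),
    ENNReal.ofReal_eq_one, integral_add (integrable_const 1) hg] at h
  simpa using h

/-- The chi-square divergence between product measures whose factors have relative densities
`1 + δ * gᵢ`. -/
lemma integral_sq_prod_sub_one_le {n : ℕ} {b : Fin n → Measure Y}
    [∀ i, IsProbabilityMeasure (b i)] {g : Fin n → Y → ℝ} {K : Fin n → ℝ}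
    (hg : ∀ i, Measurable (g i)) (hK : ∀ i y, |g i y| ≤ K i) (h0 : ∀ i, ∫ y, g i y ∂(b i) = 0)
    (δ : ℝ) :
    Integrable (fun y : Fin n → Y => (∏ i, (1 + δ * g i (y i)) - 1) ^ 2) (Measure.pi b) ∧
    ∫ y, (∏ i, (1 + δ * g i (y i)) - 1) ^ 2 ∂(Measure.pi b) ≤
      Real.exp (δ ^ 2 * ∑ i, K i ^ 2) - 1 := by
  have hgi : ∀ i, Integrable (g i) (b i) := fun i => integrable_of_abs_le (hg i) (hK i)
  have hgi2 : ∀ i, Integrable (fun y => g i y ^ 2) (b i) := fun i =>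
    integrable_of_abs_le (K := K i ^ 2) ((hg i).pow_const 2) fun y => by
      rw [abs_pow]; exact pow_le_pow_left₀ (abs_nonneg _) (hK i y) 2
  have hL : Integrable (fun y : Fin n → Y => ∏ i, (1 + δ * g i (y i))) (Measure.pi b) :=
    Integrable.fintype_prod (f := fun i y => 1 + δ * g i y) fun i =>
      (integrable_const 1).add ((hgi i).const_mul δ)
  have hsq : ∀ i, (fun y => (1 + δ * g i y) ^ 2) =
      fun y => 1 + 2 * δ * g i y + δ ^ 2 * g i y ^ 2 := fun i => by funext y; ring
  have hi1 : ∀ i, Integrable (fun y => 1 + 2 * δ * g i y) (b i) := fun i =>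
    (integrable_const 1).add ((hgi i).const_mul (2 * δ))
  have hL2 : Integrable (fun y : Fin n → Y => ∏ i, (1 + δ * g i (y i)) ^ 2) (Measure.pi b) :=
    Integrable.fintype_prod (f := fun i y => (1 + δ * g i y) ^ 2) fun i => by
      rw [hsq i]
      exact (hi1 i).add ((hgi2 i).const_mul (δ ^ 2))
  have hexp : (fun y : Fin n → Y => (∏ i, (1 + δ * g i (y i)) - 1) ^ 2) = fun y =>
      ∏ i, (1 + δ * g i (y i)) ^ 2 - 2 * ∏ i, (1 + δ * g i (y i)) + 1 := by
    funext y
    rw [Finset.prod_pow]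
    ring
  have hEL : ∫ y, ∏ i, (1 + δ * g i (y i)) ∂(Measure.pi b) = 1 := by
    rw [integral_fintype_prod_eq_prod (fun i y => 1 + δ * g i y)]
    refine Finset.prod_eq_one fun i _ => ?_
    rw [integral_add (integrable_const 1) ((hgi i).const_mul δ), integral_const_mul, h0 i]
    simp
  -- Since `g i` has mean zero, each factor is `1 + δ² E[g²] ≤ 1 + δ² K² ≤ exp (δ² K²)`.
  have hEL2 : ∫ y, ∏ i, (1 + δ * g i (y i)) ^ 2 ∂(Measure.pi b) ≤
      Real.exp (δ ^ 2 * ∑ i, K i ^ 2) := by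
    rw [integral_fintype_prod_eq_prod (fun i y => (1 + δ * g i y) ^ 2), Finset.mul_sum,
      Real.exp_sum]
    refine Finset.prod_le_prod (fun i _ => integral_nonneg fun y => sq_nonneg _) fun i _ => ?_
    rw [hsq i, integral_add (hi1 i) ((hgi2 i).const_mul (δ ^ 2)),
      integral_add (integrable_const 1) ((hgi i).const_mul (2 * δ)), integral_const_mul,
      integral_const_mul, h0 i]
    have hm : ∫ y, g i y ^ 2 ∂(b i) ≤ K i ^ 2 := by
      have := integral_mono (hgi2 i) (integrable_const (μ := b i) (K i ^ 2)) fun y => by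
        have := pow_le_pow_left₀ (abs_nonneg _) (hK i y) 2
        rwa [sq_abs] at this
      simpa using this
    have h1 := mul_le_mul_of_nonneg_left hm (sq_nonneg δ)
    have h2 := Real.add_one_le_exp (δ ^ 2 * K i ^ 2)
    simp only [integral_const, probReal_univ, smul_eq_mul, mul_zero, mul_one]
    linarith
  have hi2 : Integrable (fun y : Fin n → Y =>
      ∏ i, (1 + δ * g i (y i)) ^ 2 - 2 * ∏ i, (1 + δ * g i (y i))) (Measure.pi b) :=
    hL2.sub (hL.const_mul 2)
  rw [hexp]
  refine ⟨hi2.add (integrable_const 1), ?_⟩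
  rw [integral_add hi2 (integrable_const 1), integral_sub hL2 (hL.const_mul 2),
    integral_const_mul, hEL]
  simp only [integral_const, probReal_univ, smul_eq_mul, mul_one]
  linarith

/-- Le Cam's two-point bound for the squared error, with a chi-square bound on the likelihood
ratio `L`. -/
lemma two_point_lower_bound {ν : Measure Y} [IsProbabilityMeasure ν] {L : Y → ℝ}
    (hLm : Measurable L) (hL0 : ∀ y, 0 ≤ L y)
    (hLi : Integrable (fun y => (L y - 1) ^ 2) ν) (hL : ∫ y, (L y - 1) ^ 2 ∂ν ≤ 1 / 3)
    (T : Kernel Y ℝ) [IsMarkovKernel T] (m₀ m₁ : ℝ) :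
    ENNReal.ofReal (5 / 24 * (m₁ - m₀) ^ 2) ≤
      ∫⁻ y, ∫⁻ t, ENNReal.ofReal ((t - m₀) ^ 2) ∂(T y) ∂ν +
      ∫⁻ y, ∫⁻ t, ENNReal.ofReal ((t - m₁) ^ 2) ∂(T y)
        ∂(ν.withDensity fun y => ENNReal.ofReal (L y)) := by
  have hm : ∀ m : ℝ, Measurable fun y => ∫⁻ t, ENNReal.ofReal ((t - m) ^ 2) ∂(T y) := fun m =>
    Measurable.lintegral_kernel (by fun_prop)
  have hφi : Integrable (fun y => min 1 (L y)) ν :=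
    integrable_of_abs_le (K := 1) (by fun_prop) fun y => by
      rw [abs_of_nonneg (le_min zero_le_one (hL0 y))]
      exact min_le_left _ _
  have hφ : 5 / 12 ≤ ∫ y, min 1 (L y) ∂ν := by
    -- The parabola `3/4 - (L - 1)²` lies below `1` and is tangent to `L` at `1/2`; integrating
    -- gives `3/4 - 1/3 = 5/12`.
    have h1 : ∫ y, (3 / 4 - (L y - 1) ^ 2) ∂ν ≤ ∫ y, min 1 (L y) ∂ν := by
      refine integral_mono ((integrable_const _).sub hLi) hφi fun y => le_min ?_ ?_
      · nlinarith [sq_nonneg (L y - 1)]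
      · nlinarith [sq_nonneg (L y - 1 / 2)]
    rw [integral_sub (integrable_const _) hLi] at h1
    simp only [integral_const, probReal_univ, smul_eq_mul, one_mul] at h1
    linarith
  -- No `t` is close to both means: `(t - m₀)² + (t - m₁)² ≥ (m₁ - m₀)² / 2`.
  have hpt : ∀ y, ENNReal.ofReal ((m₁ - m₀) ^ 2 / 2) ≤
      ∫⁻ t, ENNReal.ofReal ((t - m₀) ^ 2) ∂(T y) +
        ∫⁻ t, ENNReal.ofReal ((t - m₁) ^ 2) ∂(T y) := fun y => by
    rw [← lintegral_add_left (by fun_prop)]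
    calc ENNReal.ofReal ((m₁ - m₀) ^ 2 / 2)
        = ∫⁻ _, ENNReal.ofReal ((m₁ - m₀) ^ 2 / 2) ∂(T y) := by simp
      _ ≤ _ := lintegral_mono fun t => by
        rw [← ENNReal.ofReal_add (sq_nonneg _) (sq_nonneg _)]
        refine ENNReal.ofReal_le_ofReal ?_
        nlinarith [sq_nonneg ((t - m₀) + (t - m₁))]
  rw [lintegral_withDensity_eq_lintegral_mul _ (by fun_prop) (hm m₁),
    ← lintegral_add_left (hm m₀)]
  calc ENNReal.ofReal (5 / 24 * (m₁ - m₀) ^ 2)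
      = ENNReal.ofReal (5 / 12) * ENNReal.ofReal ((m₁ - m₀) ^ 2 / 2) := by
        rw [← ENNReal.ofReal_mul (by norm_num)]
        congr 1
        ring
    _ ≤ (∫⁻ y, ENNReal.ofReal (min 1 (L y)) ∂ν) * ENNReal.ofReal ((m₁ - m₀) ^ 2 / 2) := by
        rw [← ofReal_integral_eq_lintegral_ofReal hφi
          (Filter.Eventually.of_forall fun y => le_min zero_le_one (hL0 y))]
        gcongr
    _ = ∫⁻ y, ENNReal.ofReal (min 1 (L y)) * ENNReal.ofReal ((m₁ - m₀) ^ 2 / 2) ∂ν :=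
        (lintegral_mul_const _ (by fun_prop)).symm
    _ ≤ _ := lintegral_mono fun y => by
        refine (mul_le_mul_right (hpt y) _).trans ?_
        rw [mul_add]
        refine add_le_add ?_ ?_
        · refine (mul_le_mul_left (ENNReal.ofReal_le_ofReal (min_le_left _ _)) _).trans ?_
          simp
        · exact mul_le_mul_left (ENNReal.ofReal_le_ofReal (min_le_right _ _)) _

end Density

/-! ### The two hypotheses and the minimax lower bound -/

/-- The distribution on `{-1/2, 1/2}` with mass `δ` at `1/2`. -/
noncomputable def twoPoint (δ : ℝ) : Measure ℝ :=
  ENNReal.ofReal (1 - δ) • Measure.dirac (-(1 / 2)) + ENNReal.ofReal δ • Measure.dirac (1 / 2)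

lemma isProbabilityMeasure_twoPoint {δ : ℝ} (h0 : 0 ≤ δ) (h1 : δ ≤ 1) :
    IsProbabilityMeasure (twoPoint δ) := by
  constructor
  simp [twoPoint, ← ENNReal.ofReal_add (sub_nonneg.mpr h1) h0]

lemma integral_twoPoint {δ : ℝ} (h0 : 0 ≤ δ) (h1 : δ ≤ 1) :
    ∫ x, x ∂(twoPoint δ) = -(1 / 2) + δ := by
  rw [twoPoint, integral_add_measure
    ((integrable_dirac (by simp)).smul_measure ENNReal.ofReal_ne_top)
    ((integrable_dirac (by simp)).smul_measure ENNReal.ofReal_ne_top),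
    integral_smul_measure, integral_smul_measure, integral_dirac, integral_dirac,
    ENNReal.toReal_ofReal (sub_nonneg.mpr h1), ENNReal.toReal_ofReal h0, smul_eq_mul, smul_eq_mul]
  ring

lemma ae_abs_le_twoPoint (δ : ℝ) : ∀ᵐ x ∂(twoPoint δ), |x| ≤ 1 / 2 := by
  rw [twoPoint, ae_add_measure_iff]
  have h : MeasurableSet {x : ℝ | |x| ≤ 1 / 2} := measurableSet_le (by fun_prop) (by fun_prop)
  constructor <;> refine Measure.ae_smul_measure ?_ _ <;> rw [ae_dirac_iff h]
  · rw [abs_neg, abs_of_pos (by norm_num)]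
  · rw [abs_of_pos (by norm_num)]

/-- The output law is a mixture with weights `1 - δ` and `δ`, and `(1 - δ) + δ (1 + g) = 1 + δ g`.
-/
lemma twoPoint_bind {Y : Type*} [MeasurableSpace Y] (κ : Kernel ℝ Y) {δ : ℝ} (h0 : 0 ≤ δ)
    (h1 : δ ≤ 1) {g : Y → ℝ} (hg : Measurable g) (hg1 : ∀ y, 0 ≤ 1 + g y)
    (h : κ (1 / 2) = (κ (-(1 / 2))).withDensity fun y => ENNReal.ofReal (1 + g y)) :
    (twoPoint δ).bind κ =
      (κ (-(1 / 2))).withDensity fun y => ENNReal.ofReal (1 + δ * g y) := by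
  have hfun : (fun y => ENNReal.ofReal (1 + δ * g y)) =
      (fun _ => ENNReal.ofReal (1 - δ)) + ENNReal.ofReal δ • fun y => ENNReal.ofReal (1 + g y) := by
    funext y
    simp only [Pi.add_apply, Pi.smul_apply, smul_eq_mul]
    rw [← ENNReal.ofReal_mul h0, ← ENNReal.ofReal_add (sub_nonneg.mpr h1)
      (mul_nonneg h0 (hg1 y))]
    congr 1
    ring
  rw [hfun, withDensity_add_left measurable_const, withDensity_smul _ (by fun_prop), ← h,
    withDensity_const, twoPoint]
  ext s hs
  rw [Measure.bind_apply hs κ.measurable.aemeasurable, lintegral_add_measure,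
    lintegral_smul_measure, lintegral_smul_measure, lintegral_dirac' _ (κ.measurable_coe hs),
    lintegral_dirac' _ (κ.measurable_coe hs)]
  simp

lemma localMinimax_lower_bound {n : ℕ} {ε : Fin n → ℝ} (h0 : ∀ i, 0 ≤ ε i) (h1 : ∀ i, ε i ≤ 1)
    (Y : Type*) [MeasurableSpace Y] {δ : ℝ} (hδ0 : 0 ≤ δ) (hδ1 : δ ≤ 1 / 2)
    (hδ : δ ^ 2 * ∑ i, (2 * ε i) ^ 2 ≤ 1 / 4) :
    ENNReal.ofReal (5 / 48 * δ ^ 2) ≤ localMinimax dataSpace boundedFamily ε Y := by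
  refine le_iInf fun M => le_iInf fun hM => le_iInf fun T => le_iInf fun hT => ?_
  obtain ⟨C, hC, hdp, rfl⟩ := hM
  have hmem : (1 / 2 : ℝ) ∈ dataSpace ∧ (-(1 / 2) : ℝ) ∈ dataSpace := by
    simp only [dataSpace, Set.mem_Icc]; norm_num
  choose g hgm hgb hg1 hgd using fun i => exists_density_of_le (Real.one_le_exp (h0 i))
    (hdp i _ hmem.1 _ hmem.2) (hdp i _ hmem.2 _ hmem.1)
  have hgK : ∀ i y, |g i y| ≤ 2 * ε i := fun i y => by
    have := Real.abs_exp_sub_one_le (x := ε i) (by rw [abs_of_nonneg (h0 i)]; exact h1 i)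
    rw [abs_of_nonneg (h0 i)] at this
    exact (hgb i y).trans ((le_abs_self _).trans this)
  have hg0 : ∀ i, ∫ y, g i y ∂(C i (-(1 / 2))) = 0 := fun i => by
    have : IsProbabilityMeasure
        ((C i (-(1 / 2))).withDensity fun y => ENNReal.ofReal (1 + g i y)) := by
      rw [← hgd i]; infer_instance
    exact integral_eq_zero_of_density (integrable_of_abs_le (hgm i) (hgK i)) (hg1 i)
  have hfac : ∀ i y, 0 ≤ 1 + δ * g i y := fun i y => by
    nlinarith [hg1 i y, mul_nonneg hδ0 (hg1 i y)]
  set ν := Measure.pi fun i => C i (-(1 / 2)) with hν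
  obtain ⟨hLi, hL⟩ := integral_sq_prod_sub_one_le hgm hgK hg0 δ
  -- `exp (-1/4) ≥ 3/4` gives `exp (1/4) ≤ 4/3`.
  have hL3 : Real.exp (δ ^ 2 * ∑ i, (2 * ε i) ^ 2) - 1 ≤ 1 / 3 := by
    have h2 : (3 / 4 : ℝ) ≤ Real.exp (-(1 / 4)) := by
      linarith [Real.add_one_le_exp (-(1 / 4) : ℝ)]
    have h3 : Real.exp (1 / 4) * Real.exp (-(1 / 4)) = 1 := by
      rw [← Real.exp_add]; simp
    have h4 := Real.exp_le_exp.mpr hδ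
    nlinarith [Real.exp_pos (1 / 4)]
  have hprob : ∀ r, 0 ≤ r → r ≤ 1 / 2 → ∃ P : ProbabilityMeasure ℝ, P ∈ boundedFamily ∧
      (P : Measure ℝ) = twoPoint r ∧ mean P = -(1 / 2) + r := fun r hr0 hr1 =>
    ⟨⟨twoPoint r, isProbabilityMeasure_twoPoint hr0 (by linarith)⟩, ae_abs_le_twoPoint r, rfl,
      integral_twoPoint hr0 (by linarith)⟩
  obtain ⟨P₀, hP₀, hP₀t, hm₀⟩ := hprob 0 le_rfl (by norm_num)
  obtain ⟨P₁, hP₁, hP₁t, hm₁⟩ := hprob δ hδ0 hδ1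
  have hbind := fun r h0 h1 i => twoPoint_bind (C i) (δ := r) h0 h1 (hgm i) (hg1 i) (hgd i)
  have hR₀ : sqRisk (productMechanism C) T P₀ =
      ∫⁻ y, ∫⁻ t, ENNReal.ofReal ((t - mean P₀) ^ 2) ∂(T y) ∂ν := by
    rw [sqRisk_productMechanism]
    simp [hP₀t, hbind 0 le_rfl zero_le_one, hν]
  have hR₁ : sqRisk (productMechanism C) T P₁ =
      ∫⁻ y, ∫⁻ t, ENNReal.ofReal ((t - mean P₁) ^ 2) ∂(T y)
        ∂(ν.withDensity fun y => ENNReal.ofReal (∏ i, (1 + δ * g i (y i)))) := by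
    have hpm : ∀ i, IsProbabilityMeasure
        ((C i (-(1 / 2))).withDensity fun y => ENNReal.ofReal (1 + δ * g i y)) := fun i => by
      have := P₁.2
      rw [← hbind δ hδ0 (by linarith) i, ← hP₁t]
      infer_instance
    rw [sqRisk_productMechanism]
    simp only [hP₁t, hbind δ hδ0 (by linarith)]
    rw [pi_withDensity _ fun i => by have := hgm i; fun_prop]
    simp only [ENNReal.ofReal_prod_of_nonneg fun i _ => hfac i _, hν]
  have hmain := two_point_lower_bound (ν := ν) (L := fun y => ∏ i, (1 + δ * g i (y i)))
    (Finset.measurable_fun_prod _ fun i _ =>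
      (((hgm i).comp (measurable_pi_apply i)).const_mul δ).const_add 1)
    (fun y => Finset.prod_nonneg fun i _ => hfac i _) hLi (hL.trans hL3) T (mean P₀) (mean P₁)
  rw [← hR₀, ← hR₁, hm₀, hm₁] at hmain
  have hs₀ := le_iSup₂ (f := fun P (_ : P ∈ boundedFamily) =>
    sqRisk (productMechanism C) T P) P₀ hP₀
  have hs₁ := le_iSup₂ (f := fun P (_ : P ∈ boundedFamily) =>
    sqRisk (productMechanism C) T P) P₁ hP₁
  have h2 := hmain.trans (add_le_add hs₀ hs₁)
  -- The two risks sum to at most twice the supremum, which halves `5/24` to `5/48`.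
  have h3 : ENNReal.ofReal (5 / 24 * (-(1 / 2) + δ - (-(1 / 2) + 0)) ^ 2) =
      ENNReal.ofReal (5 / 48 * δ ^ 2) * 2 := by
    rw [← ENNReal.ofReal_ofNat 2, ← ENNReal.ofReal_mul (by positivity)]
    congr 1
    ring
  rw [h3, ← mul_two] at h2
  exact (ENNReal.mul_le_mul_iff_left (by norm_num) (by norm_num)).mp h2

/-! ### Laplace noise: moments and privacy -/

section Laplace

variable {b : ℝ}

lemma integral_laplaceMeasure (hb : 0 < b) (f : ℝ → ℝ) :
    ∫ z, f z ∂(laplaceMeasure b) = ∫ z, 1 / (2 * b) * Real.exp (-|z| / b) * f z := by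
  rw [laplaceMeasure, integral_withDensity_eq_integral_toReal_smul (by fun_prop)
    (Filter.Eventually.of_forall fun z => ENNReal.ofReal_lt_top)]
  refine integral_congr_ae (Filter.Eventually.of_forall fun z => ?_)
  simp only [smul_eq_mul]
  rw [ENNReal.toReal_ofReal (by positivity)]

lemma integral_sq_laplaceMeasure (hb : 0 < b) :
    ∫ z, z ^ 2 ∂(laplaceMeasure b) = 2 * b ^ 2 := by
  have h := integral_comp_abs (f := fun z : ℝ => 1 / (2 * b) * Real.exp (-z / b) * z ^ 2)
  simp only [sq_abs] at h
  -- The half-line second moment is a Gamma integral, with `Γ(3) = 2`.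
  have h2 := Real.integral_rpow_mul_exp_neg_mul_Ioi (a := 3) (r := 1 / b) (by norm_num)
    (by positivity)
  have h3 : ∫ z in Set.Ioi (0 : ℝ), 1 / (2 * b) * Real.exp (-z / b) * z ^ 2 =
      1 / (2 * b) * ∫ z in Set.Ioi (0 : ℝ), z ^ ((3 : ℝ) - 1) * Real.exp (-(1 / b * z)) := by
    rw [← integral_const_mul]
    refine setIntegral_congr_fun measurableSet_Ioi fun z _ => ?_
    have e1 : -z / b = -(1 / b * z) := by ring
    have e2 : z ^ ((3 : ℝ) - 1) = z ^ 2 := by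
      rw [← Real.rpow_natCast]; norm_num
    simp only [e1, e2]
    ring
  have h4 : Real.Gamma 3 = 2 := by simp
  have h5 : (1 / (1 / b)) ^ (3 : ℝ) = b ^ 3 := by
    rw [one_div_one_div, ← Real.rpow_natCast]; norm_num
  rw [integral_laplaceMeasure hb, h, h3, h2, h4, h5]
  field_simp

lemma memLp_id_laplaceMeasure (hb : 0 < b) : MemLp (fun z : ℝ => z) 2 (laplaceMeasure b) := by
  rw [memLp_two_iff_integrable_sq (by fun_prop)]
  -- A non-integrable function would have integral `0` by convention, but the second moment is `2 b²
  -- > 0`.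
  by_contra hcon
  have h := integral_sq_laplaceMeasure hb
  rw [integral_undef hcon] at h
  have : 0 < b ^ 2 := by positivity
  linarith

lemma integral_id_laplaceMeasure (hb : 0 < b) : ∫ z, z ∂(laplaceMeasure b) = 0 := by
  rw [integral_laplaceMeasure hb]
  have h := integral_neg_eq_self (fun z : ℝ => 1 / (2 * b) * Real.exp (-|z| / b) * z) volume
  simp only [abs_neg, mul_neg, integral_neg] at h
  linarith

lemma variance_laplaceMeasure_le (hb : 0 < b) :
    Var[fun z : ℝ => z; laplaceMeasure b] ≤ 2 * b ^ 2 := by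
  have := isProbabilityMeasure_laplaceMeasure hb
  rw [← integral_sq_laplaceMeasure hb]
  exact variance_le_expectation_sq (by fun_prop)

lemma laplaceChannel_of_pos {ε : ℝ} (hε : 0 < ε) :
    laplaceChannel ε = (Kernel.id ×ₖ Kernel.const ℝ (laplaceMeasure (1 / ε))).map
      fun p : ℝ × ℝ => p.1 + p.2 := if_pos hε

lemma laplaceChannel_apply {ε : ℝ} (hε : 0 < ε) (x : ℝ) {W : Set ℝ} (hW : MeasurableSet W) :
    laplaceChannel ε x W =
      ∫⁻ y in W, ENNReal.ofReal (ε / 2 * Real.exp (-(ε * |y - x|))) := by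
  have := isProbabilityMeasure_laplaceMeasure (one_div_pos.mpr hε)
  rw [laplaceChannel_of_pos hε, Kernel.map_apply' _ (by fun_prop) _ hW, Kernel.prod_apply,
    Kernel.id_apply, Kernel.const_apply, Measure.dirac_prod,
    Measure.map_apply (by fun_prop) (measurableSet_preimage (by fun_prop) hW), laplaceMeasure,
    withDensity_apply _ (measurableSet_preimage (by fun_prop)
      (measurableSet_preimage (by fun_prop) hW)),
    ← lintegral_indicator (measurableSet_preimage (by fun_prop)
      (measurableSet_preimage (by fun_prop) hW)),
    ← lintegral_indicator hW, ← lintegral_sub_right_eq_self _ x]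
  refine lintegral_congr fun y => ?_
  have hmem : y - x ∈ Prod.mk x ⁻¹' ((fun p : ℝ × ℝ => p.1 + p.2) ⁻¹' W) ↔ y ∈ W := by
    simp
  by_cases hy : y ∈ W
  swap
  · rw [Set.indicator_of_notMem (mt hmem.mp hy), Set.indicator_of_notMem hy]
  rw [Set.indicator_of_mem (hmem.mpr hy), Set.indicator_of_mem hy]
  congr 2
  · field_simp
  · congr 1
    field_simp

lemma isLocallyDP_laplaceChannel {ε : ℝ} (hε : 0 ≤ ε) :
    IsLocallyDP dataSpace ε (laplaceChannel ε) := by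
  intro x hx x' hx' W hW
  rcases hε.eq_or_lt with rfl | hε
  · simp [laplaceChannel]
  rw [laplaceChannel_apply hε x hW, laplaceChannel_apply hε x' hW,
    ← lintegral_const_mul _ (by fun_prop)]
  refine lintegral_mono fun y => ?_
  rw [← ENNReal.ofReal_mul (Real.exp_pos _).le]
  refine ENNReal.ofReal_le_ofReal ?_
  -- The data space has diameter `1`, so changing the input alters the exponent by at most `ε`.
  have h1 : |x - x'| ≤ 1 := by
    rw [abs_le]; constructor <;> linarith [hx.1, hx.2, hx'.1, hx'.2]
  have h2 : |y - x'| ≤ |y - x| + |x - x'| := abs_sub_le y x x'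
  have h3 : Real.exp (-(ε * |y - x|)) ≤ Real.exp ε * Real.exp (-(ε * |y - x'|)) := by
    rw [← Real.exp_add]
    refine Real.exp_le_exp.mpr ?_
    nlinarith
  nlinarith

lemma laplaceMechanism_mem {n : ℕ} {ε : Fin n → ℝ} (h0 : ∀ i, 0 ≤ ε i) :
    laplaceMechanism ε ∈ locallyDPMechanisms dataSpace ε ℝ :=
  ⟨fun i => laplaceChannel (ε i), fun _ => inferInstance,
    fun i => isLocallyDP_laplaceChannel (h0 i), rfl⟩

lemma bind_laplaceChannel {ε : ℝ} (hε : 0 < ε) (P : Measure ℝ) [IsProbabilityMeasure P] :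
    P.bind (laplaceChannel ε) =
      (P.prod (laplaceMeasure (1 / ε))).map fun p : ℝ × ℝ => p.1 + p.2 := by
  have := isProbabilityMeasure_laplaceMeasure (one_div_pos.mpr hε)
  rw [laplaceChannel_of_pos hε, ← Measure.map_comp _ _ (by fun_prop),
    ← Measure.compProd_eq_comp_prod, Measure.compProd_const]

end Laplace

/-! ### Risk of the weighted Laplace estimator -/

lemma memLp_id_of_mem_boundedFamily {P : ProbabilityMeasure ℝ} (hP : P ∈ boundedFamily) :
    MemLp (fun x : ℝ => x) 2 (P : Measure ℝ) :=
  MemLp.of_bound (by fun_prop) (1 / 2) hP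

/-- Data and noise are independent and the noise is centred, so variances add: at most `1/4` from a
variable on an interval of length one, and `2/ε²` from the noise. -/
lemma moments_bind_laplaceChannel {ε : ℝ} (hε : 0 < ε) {P : ProbabilityMeasure ℝ}
    (hP : P ∈ boundedFamily) :
    MemLp (fun y : ℝ => y) 2 ((P : Measure ℝ).bind (laplaceChannel ε)) ∧
    ∫ y, y ∂((P : Measure ℝ).bind (laplaceChannel ε)) = mean P ∧
    Var[fun y : ℝ => y; (P : Measure ℝ).bind (laplaceChannel ε)] ≤ 1 / 4 + 2 * (1 / ε) ^ 2 := by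
  have hb := one_div_pos.mpr hε
  have := isProbabilityMeasure_laplaceMeasure hb
  set Q := laplaceMeasure (1 / ε)
  have hadd : Measurable fun p : ℝ × ℝ => p.1 + p.2 := by fun_prop
  have hfst : MemLp (fun p : ℝ × ℝ => p.1) 2 ((P : Measure ℝ).prod Q) :=
    (memLp_id_of_mem_boundedFamily hP).comp_measurePreserving measurePreserving_fst
  have hsnd : MemLp (fun p : ℝ × ℝ => p.2) 2 ((P : Measure ℝ).prod Q) :=
    (memLp_id_laplaceMeasure hb).comp_measurePreserving measurePreserving_snd
  rw [bind_laplaceChannel hε]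
  refine ⟨?_, ?_, ?_⟩
  · rw [memLp_map_measure_iff (by fun_prop) hadd.aemeasurable]
    exact hfst.add hsnd
  · rw [integral_map hadd.aemeasurable (by fun_prop),
      integral_add (hfst.integrable one_le_two) (hsnd.integrable one_le_two),
      integral_fun_fst (fun x : ℝ => x), integral_fun_snd (fun x : ℝ => x),
      integral_id_laplaceMeasure hb]
    simp [mean]
  · rw [variance_map (by fun_prop) hadd.aemeasurable]
    have hind : IndepFun (fun p : ℝ × ℝ => p.1) (fun p : ℝ × ℝ => p.2)
        ((P : Measure ℝ).prod Q) :=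
      indepFun_prod (X := fun x : ℝ => x) (Y := fun y : ℝ => y) measurable_id measurable_id
    refine (hind.variance_add hfst hsnd).trans_le ?_
    have e1 : Var[fun p : ℝ × ℝ => p.1; (P : Measure ℝ).prod Q] =
        Var[fun x : ℝ => x; (P : Measure ℝ)] := by
      rw [← (measurePreserving_fst (μ := (P : Measure ℝ)) (ν := Q)).map_eq,
        variance_map (by fun_prop) (by fun_prop)]
      simp [Function.comp_def]
    have e2 : Var[fun p : ℝ × ℝ => p.2; (P : Measure ℝ).prod Q] =
        Var[fun x : ℝ => x; Q] := by
      rw [← (measurePreserving_snd (μ := (P : Measure ℝ)) (ν := Q)).map_eq,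
        variance_map (by fun_prop) (by fun_prop)]
      simp [Function.comp_def]
    rw [e1, e2]
    have e3 : Var[fun x : ℝ => x; (P : Measure ℝ)] ≤ 1 / 4 := by
      refine (variance_le_sq_of_bounded (a := -(1 / 2)) (b := 1 / 2) ?_ (by fun_prop)).trans
        (by norm_num)
      filter_upwards [hP] with x hx
      exact abs_le.mp hx
    linarith [variance_laplaceMeasure_le hb]

lemma sum_sq_pos {n : ℕ} {ε : Fin n → ℝ} (hε : ∃ i, 0 < ε i) : 0 < ∑ i, ε i ^ 2 := by
  obtain ⟨i, hi⟩ := hε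
  exact Finset.sum_pos' (fun j _ => sq_nonneg _) ⟨i, Finset.mem_univ i, by positivity⟩

lemma sum_quadraticWeights {n : ℕ} {ε : Fin n → ℝ} (hε : ∃ i, 0 < ε i) :
    ∑ i, quadraticWeights ε i = 1 := by
  simp only [quadraticWeights]
  rw [← Finset.sum_div, div_self (sum_sq_pos hε).ne']

lemma sqRisk_laplaceMechanism_le {n : ℕ} {ε : Fin n → ℝ} (h0 : ∀ i, 0 ≤ ε i)
    (h1 : ∀ i, ε i ≤ 1) (hε : ∃ i, 0 < ε i) {P : ProbabilityMeasure ℝ}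
    (hP : P ∈ boundedFamily) :
    sqRisk (laplaceMechanism ε) (linearEstimator (quadraticWeights ε)) P ≤
      ENNReal.ofReal (9 / 4 / ∑ i, ε i ^ 2) := by
  have hS := sum_sq_pos hε
  set w := quadraticWeights ε with hw
  set R : Fin n → Measure ℝ := fun i => (P : Measure ℝ).bind (laplaceChannel (ε i)) with hR
  have hcoord : ∀ i, MemLp (fun y : ℝ => w i * y) 2 (R i) ∧
      ∫ y, w i * y ∂(R i) = w i * mean P ∧
      Var[fun y : ℝ => w i * y; R i] ≤ 9 / 4 * ε i ^ 2 / (∑ j, ε j ^ 2) ^ 2 := fun i => by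
    -- A user at level zero reports a constant carrying no information about the mean, but her
    -- weight vanishes.
    rcases (h0 i).eq_or_lt with h | h
    · have hwi : w i = 0 := by simp [hw, quadraticWeights, ← h]
      have hz : MemLp (fun _ : ℝ => (0 : ℝ)) 2 (R i) := memLp_const 0
      have hv : Var[fun _ : ℝ => (0 : ℝ); R i] = 0 := variance_zero _
      simp only [hwi, zero_mul, hv, integral_zero]
      exact ⟨hz, trivial, by positivity⟩
    · obtain ⟨hm, hi, hv⟩ := moments_bind_laplaceChannel h hP
      refine ⟨hm.const_mul _, by rw [integral_const_mul, hi], ?_⟩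
      rw [variance_const_mul]
      refine (mul_le_mul_of_nonneg_left hv (sq_nonneg _)).trans ?_
      -- This is where `ε ≤ 1` enters: `ε²/4 + 2 ≤ 9/4`.
      have h2 : ε i ^ 2 ≤ 1 := pow_le_one₀ h.le (h1 i)
      have h3 : w i ^ 2 * (1 / 4 + 2 * (1 / ε i) ^ 2) =
          (ε i ^ 2 / 4 + 2) * ε i ^ 2 / (∑ j, ε j ^ 2) ^ 2 := by
        simp only [hw, quadraticWeights]
        field_simp
      rw [h3]
      gcongr
      linarith
  -- The weights sum to one, so the estimator is unbiased and its risk is its variance.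
  have hrisk : sqRisk (laplaceMechanism ε) (linearEstimator w) P =
      eVar[∑ i, fun y : Fin n → ℝ => w i * y i; Measure.pi R] := by
    have hmean : ∫ y, (∑ i, fun y : Fin n → ℝ => w i * y i) y ∂(Measure.pi R) = mean P := by
      have hint : ∀ i, Integrable (fun y : Fin n → ℝ => w i * y i) (Measure.pi R) := fun i =>
        ((hcoord i).1.comp_measurePreserving (measurePreserving_eval R i)).integrable one_le_two
      simp only [Finset.sum_apply]
      rw [integral_finsetSum _ fun i _ => hint i]
      have : ∀ i, ∫ y : Fin n → ℝ, w i * y i ∂(Measure.pi R) = w i * mean P := fun i => by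
        rw [integral_comp_eval (μ := R) (f := fun y => w i * y) (by fun_prop), (hcoord i).2.1]
      simp only [this]
      rw [← Finset.sum_mul, hw, sum_quadraticWeights hε, one_mul]
    rw [evariance_eq_lintegral_ofReal, hmean, laplaceMechanism, sqRisk_productMechanism]
    refine lintegral_congr fun y => ?_
    rw [linearEstimator, Kernel.deterministic_apply, lintegral_dirac' _ (by fun_prop),
      Finset.sum_apply]
  have hmem : MemLp (∑ i, fun y : Fin n → ℝ => w i * y i) 2 (Measure.pi R) :=
    memLp_finsetSum' _ fun i _ => (hcoord i).1.comp_measurePreserving (measurePreserving_eval R i)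
  rw [hrisk, ← ofReal_variance hmem,
    variance_sum_pi (X := fun i y => w i * y) fun i => (hcoord i).1]
  refine ENNReal.ofReal_le_ofReal ((Finset.sum_le_sum fun i _ => (hcoord i).2.2).trans_eq ?_)
  rw [← Finset.sum_div, ← Finset.mul_sum]
  field_simp

/-! ### Choice of the separation and the final constants -/

lemma min_le_localMinimax {n : ℕ} {ε : Fin n → ℝ} (h0 : ∀ i, 0 ≤ ε i) (h1 : ∀ i, ε i ≤ 1)
    (Y : Type*) [MeasurableSpace Y] :
    ENNReal.ofReal (5 / 768) * min (1 / ENNReal.ofReal (∑ i, ε i ^ 2)) 1 ≤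
      localMinimax dataSpace boundedFamily ε Y := by
  set S := ∑ i, ε i ^ 2 with hS
  have hS0 : 0 ≤ S := Finset.sum_nonneg fun i _ => sq_nonneg _
  have hsum : ∑ i, (2 * ε i) ^ 2 = 4 * S := by
    rw [hS, Finset.mul_sum]
    exact Finset.sum_congr rfl fun i _ => by ring
  -- The constraint is `4 δ² S ≤ 1/4`. For `S ≤ 1` the choice `δ = 1/4` suffices; otherwise `δ = 1 /
  -- (4 √S)` attains equality. In both cases the factor `1/16` in `δ²` turns `5/48` into `5/768`.
  rcases le_total S 1 with hS1 | hS1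
  · refine le_trans ?_ (localMinimax_lower_bound h0 h1 Y (δ := 1 / 4) (by norm_num) (by norm_num)
      (by rw [hsum]; linarith))
    refine (mul_le_mul_right (min_le_right _ _) _).trans ?_
    rw [mul_one]
    exact ENNReal.ofReal_le_ofReal (by norm_num)
  · have hSp : 0 < S := by linarith
    have hsq : (1 / (4 * √S)) ^ 2 = 1 / 16 * (1 / S) := by
      rw [div_pow, mul_pow, Real.sq_sqrt hS0]
      field_simp
      norm_num
    have hr : 1 ≤ √S := Real.one_le_sqrt.mpr hS1
    refine le_trans ?_ (localMinimax_lower_bound h0 h1 Y (δ := 1 / (4 * √S)) (by positivity)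
      ?_ ?_)
    · refine (mul_le_mul_right (min_le_left _ _) _).trans ?_
      rw [hsq, ← ENNReal.ofReal_one, ← ENNReal.ofReal_div_of_pos hSp,
        ← ENNReal.ofReal_mul (by norm_num)]
      exact ENNReal.ofReal_le_ofReal (le_of_eq (by ring))
    · rw [div_le_iff₀ (by positivity)]
      linarith
    · rw [hsq, hsum]
      exact le_of_eq (by field_simp; norm_num)

end LocalDP

/-- The constants are universal, and `1 / 0 = ∞` in the lower bound (values in `[0, ∞]`). -/
theorem theorem2 :
    ∃ l u : ℝ, 0 < l ∧ 0 < u ∧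
      ∀ (n : ℕ) (ε : Fin n → ℝ), (∀ i, 0 ≤ ε i) → (∀ i, ε i ≤ 1) →
        (∀ (Y : Type*) [MeasurableSpace Y],
          ENNReal.ofReal l * min (1 / ENNReal.ofReal (∑ i, ε i ^ 2)) 1 ≤
            LocalDP.localMinimax LocalDP.dataSpace LocalDP.boundedFamily ε Y) ∧
        ((∃ i, 0 < ε i) →
          ∑ i, LocalDP.quadraticWeights ε i = 1 ∧
          LocalDP.laplaceMechanism ε ∈ LocalDP.locallyDPMechanisms LocalDP.dataSpace ε ℝ ∧
          ∀ P ∈ LocalDP.boundedFamily,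
            LocalDP.sqRisk (LocalDP.laplaceMechanism ε)
                (LocalDP.linearEstimator (LocalDP.quadraticWeights ε)) P ≤
              ENNReal.ofReal (u / ∑ i, ε i ^ 2)) := by
  refine ⟨5 / 768, 9 / 4, by norm_num, by norm_num, fun n ε h0 h1 => ⟨fun Y _ => ?_, fun hε => ?_⟩⟩
  · exact LocalDP.min_le_localMinimax h0 h1 Y
  · exact ⟨LocalDP.sum_quadraticWeights hε, LocalDP.laplaceMechanism_mem h0,
      fun P hP => LocalDP.sqRisk_laplaceMechanism_le h0 h1 hε hP⟩
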